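/- **Classification as signal separation.** Let $h:\mathbb R\to\mathbb R$ be a low pass filter: $h$ is $C^\infty$ and even, $h(t)=1$ for $|t|\le 1/2$, $h(t)=0$ for $|t|\ge 1$, and $h$ is non-increasing on $[0,\infty)$. On a metric space $(\mathbb M,\rho)$ put $$\Phi_n(t)=\sum_{|\ell|\le n}h\Big(\frac{|\ell|}{n}\Big)e^{i\ell t},\qquad \Psi_n(x,y)=\Phi_n(\rho(x,y))^2 ,$$ and for points $x_1,\dots,x_M\in\mathbb M$ let $$F_n(x)=\frac1M\sum_{j=1}^M\Psi_n(x,x_j),\qquad \mathcal G_n(\Theta)=\Big\{x\in\mathbb M: F_n(x)\ge\Theta\max_{1\le k\le M}F_n(x_k)\Big\}.$$ For $A\subseteq\mathbb M$ write $\mathbb B(A,\delta)=\{x:\rho(x,A)\le\delta\}$ (empty if $A=\emptyset$), and $\mathbb B(x,\delta)$ for the closed ball. Let $\alpha\ge0$, $\kappa_1,\kappa_2>0$, $0<r_0\le\pi$ and $S>\alpha$. A measure $\mu$ on $\mathbb M$ with support $\mathbb X$ is *detectable* (with these parameters) if $\mu(\mathbb B(x,r))\le\kappa_1r^\alpha$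 for all $x\in\mathbb M$, $0<r\le\pi$, and $\mu(\mathbb B(x,r))\ge\kappa_2r^\alpha$ for all $x\in\mathbb X$, $0<r\le r_0$. A *fine structure* of $\mu$ consists of $\eta_0>0$ and, for each $\eta\in(0,\eta_0]$, an integer $K_\eta\ge0$ and a decomposition of $\mathbb X$ into pairwise disjoint measurable sets $S_{1,\eta},\dots,S_{K_\eta+1,\eta}$ (possibly empty) such that $\rho(x,y)\ge2\eta$ whenever $x\in S_{j,\eta}$, $y\in S_{k,\eta}$, $j\ne k$, $j,k\le K_\eta$, and such that $\mu(S_{K_\eta+1,\eta})\to0$ as $\eta\to0^+$. There are positive constants $C,A_1,A_2,A_3,b_1,b_2,c,c_1,c_2$ with $C<1$ and $c<1$, depending only on $h,\alpha,\kappa_1,\kappa_2,r_0,S$, and a function $r$ with $$b_1\Theta^{-1/(S-\alpha)}\le r(\Theta)\le b_2\Theta^{-1/(S-\alpha)}\qquad(0<\Theta<C),$$ such that the following holds. Let $(\mathbb M,\rho)$ be a compact metric space of diameter $\pi$, let $\mu$ be a detectable Borel probability measure on $\mathbb M$ with the above parameters, having a fine structure, let $0<\eta\le\eta_0$, $0<\Theta<C$,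 let $n,M\ge1$ be integers with $$M\ge A_1n^\alpha\log n,\qquad n\ge\frac{A_2}{\eta\,\Theta^{1/(S-\alpha)}},\qquad \mu(S_{K_\eta+1,\eta})\le A_3\,\Theta\,n^{-\alpha},$$ and let $x_1,\dots,x_M$ be independent samples from $\mu$. With $$\mathcal G_{k,\eta,n}(\Theta)=\mathcal G_n(\Theta)\cap\mathbb B(S_{k,\eta},r(\Theta)/n),$$ the following hold simultaneously with probability at least $1-c_1/M^{c_2}$: 1. $\mathbb X\subseteq\mathcal G_n(\Theta)\subseteq\mathbb B(\mathbb X,r(\Theta)/n)$; 2. $\{\mathcal G_{k,\eta,n}(\Theta)\}_{k=1}^{K_\eta}$ is a partition of $\mathcal G_n(\Theta)$: these sets are pairwise disjoint with union $\mathcal G_n(\Theta)$, and $\mathcal G_{k,\eta,n}(\Theta)\neq\emptyset$ if $S_{k,\eta}\ne\emptyset$; 3. $\rho(x,y)\ge\eta$ for all $x\in\mathcal G_{j,\eta,n}(\Theta)$, $y\in\mathcal G_{k,\eta,n}(\Theta)$, $j\ne k$; 4. $\mathbb X\cap\mathbb B(S_{k,\eta},c\,r(\Theta)/n)\subseteq\mathcal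 G_{k,\eta,n}(\Theta)\subseteq\mathbb B(S_{k,\eta},r(\Theta)/n)$ for $k=1,\dots,K_\eta$. -/

import Mathlib

universe u

open MeasureTheory Set Filter Topology

noncomputable section

/-- A low pass filter: a smooth even function equal to `1` on `[-1/2, 1/2]`, vanishing outside
`(-1, 1)`, and non-increasing on `[0, ∞)`. -/
structure IsLowPass (h : ℝ → ℝ) : Prop where
  smooth : ContDiff ℝ (⊤ : ℕ∞) h
  even : ∀ t, h (-t) = h t
  eq_one : ∀ t, |t| ≤ 1 / 2 → h t = 1
  eq_zero : ∀ t, 1 ≤ |t| → h t = 0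
  antitone : AntitoneOn h (Ici 0)

/-- The univariate trigonometric kernel `Φ_n(t) = ∑_ℓ h(|ℓ|/n) exp(iℓt)`. The terms with `|ℓ| > n`
vanish, and the sum is real because its terms of index `ℓ` and `-ℓ` are conjugate; see
`ofReal_trigKernel`. -/
def trigKernel (h : ℝ → ℝ) (n : ℕ) (t : ℝ) : ℝ :=
  ∑ l ∈ Finset.Icc (-(n : ℤ)) n, h (|(l : ℝ)| / n) * Real.cos (l * t)

theorem ofReal_trigKernel (h : ℝ → ℝ) (n : ℕ) (t : ℝ) :
    ((trigKernel h n t : ℝ) : ℂ) =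
      ∑ l ∈ Finset.Icc (-(n : ℤ)) n,
        ((h (|(l : ℝ)| / n) : ℝ) : ℂ) * Complex.exp (Complex.I * l * t) := by
  have hs : ∑ l ∈ Finset.Icc (-(n : ℤ)) n,
      h (|(l : ℝ)| / n) * Real.sin (l * t) = 0 := by
    have h1 : ∑ l ∈ Finset.Icc (-(n : ℤ)) n, h (|(l : ℝ)| / n) * Real.sin (l * t) =
        ∑ l ∈ Finset.Icc (-(n : ℤ)) n, -(h (|(l : ℝ)| / n) * Real.sin (l * t)) := by
      refine Finset.sum_nbij' (fun l => -l) (fun l => -l) ?_ ?_ ?_ ?_ ?_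
      · intro l hl
        simp only [Finset.mem_Icc] at hl ⊢
        omega
      · intro l hl
        simp only [Finset.mem_Icc] at hl ⊢
        omega
      · intro l _
        exact neg_neg l
      · intro l _
        exact neg_neg l
      · intro l _
        simp [Real.sin_neg]
    rw [Finset.sum_neg_distrib] at h1
    linarith
  have hc : ∑ l ∈ Finset.Icc (-(n : ℤ)) n,
      ((h (|(l : ℝ)| / n) : ℝ) : ℂ) * Complex.exp (Complex.I * l * t) =
      ((∑ l ∈ Finset.Icc (-(n : ℤ)) n, h (|(l : ℝ)| / n) * Real.cos (l * t) : ℝ) : ℂ) +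
      ((∑ l ∈ Finset.Icc (-(n : ℤ)) n, h (|(l : ℝ)| / n) * Real.sin (l * t) : ℝ) : ℂ)
        * Complex.I := by
    push_cast
    rw [Finset.sum_mul, ← Finset.sum_add_distrib]
    refine Finset.sum_congr rfl fun l _ => ?_
    rw [show Complex.I * l * t = ((l : ℂ) * t) * Complex.I by ring, Complex.exp_mul_I]
    ring
  rw [hc, hs]
  simp [trigKernel]

section Estimator

variable {𝕄 : Type*} [MetricSpace 𝕄]

/-- The positive localized kernel `Ψ_n(x, y) = Φ_n(ρ(x, y))²`. -/
def sqKernel (h : ℝ → ℝ) (n : ℕ) (x y : 𝕄) : ℝ :=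
  trigKernel h n (dist x y) ^ 2

/-- The measure support estimator `F_n(z) = M⁻¹ ∑_j Ψ_n(z, x_j)` of a sample `x_1, …, x_M`. -/
def supportFn (h : ℝ → ℝ) (n : ℕ) {M : ℕ} (x : Fin M → 𝕄) (z : 𝕄) : ℝ :=
  (1 / (M : ℝ)) * ∑ j, sqKernel h n z (x j)

/-- The support estimator set `𝒢_n(Θ) = {z : F_n(z) ≥ Θ max_k F_n(x_k)}`. -/
def supportSet (h : ℝ → ℝ) (n : ℕ) {M : ℕ} (x : Fin M → 𝕄) (Θ : ℝ) : Set 𝕄 :=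
  {z | Θ * (⨆ k, supportFn h n x (x k)) ≤ supportFn h n x z}

/-- The part `𝒢_n(Θ) ∩ 𝔹(A, r/n)` of the support estimator set that belongs to a class `A`. Here
`Metric.cthickening δ A` is the closed neighbourhood `𝔹(A, δ) = {z : ρ(A, z) ≤ δ}`, which is empty
if `A` is. -/
def classSet (h : ℝ → ℝ) (n : ℕ) {M : ℕ} (x : Fin M → 𝕄) (Θ r : ℝ) (A : Set 𝕄) : Set 𝕄 :=
  supportSet h n x Θ ∩ Metric.cthickening (r / n) A

variable [MeasurableSpace 𝕄]

/-- `μ` is detectable with exponent `α` and constants `κ₁, κ₂, r₀`. -/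
structure IsDetectable (μ : Measure 𝕄) (α κ₁ κ₂ r₀ : ℝ) : Prop where
  upper : ∀ x : 𝕄, ∀ r : ℝ, 0 < r → r ≤ Real.pi →
    μ.real (Metric.closedBall x r) ≤ κ₁ * r ^ α
  lower : ∀ x ∈ μ.support, ∀ r : ℝ, 0 < r → r ≤ r₀ →
    κ₂ * r ^ α ≤ μ.real (Metric.closedBall x r)

/-- A fine structure of `μ`: for each level `η ∈ (0, η₀]`, a decomposition of the support of `μ`
into `K η` classes `part η k.castSucc`, which are at distance at least `2η` from each other, and
the overlap set `part η (Fin.last _)`, whose measure tends to `0` as `η → 0+`. The overlap set may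
be empty, and so may classes, as no non-emptiness is needed. -/
structure FineStructure (μ : Measure 𝕄) where
  η₀ : ℝ
  η₀_pos : 0 < η₀
  K : ℝ → ℕ
  part : (η : ℝ) → Fin (K η + 1) → Set 𝕄
  measurable : ∀ η, 0 < η → η ≤ η₀ → ∀ k, MeasurableSet (part η k)
  iUnion_eq : ∀ η, 0 < η → η ≤ η₀ → ⋃ k, part η k = μ.support
  disjoint : ∀ η, 0 < η → η ≤ η₀ → Pairwise fun j k => Disjoint (part η j) (part η k)
  separated : ∀ η, 0 < η → η ≤ η₀ → ∀ j k : Fin (K η), j ≠ k →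
    ∀ x ∈ part η j.castSucc, ∀ y ∈ part η k.castSucc, 2 * η ≤ dist x y
  exhaustion : Tendsto (fun η => μ (part η (Fin.last (K η)))) (𝓝[>] 0) (𝓝 0)

/-- The class `S_{k,η}`, `k = 1, …, K_η`. -/
def FineStructure.cls {μ : Measure 𝕄} (F : FineStructure μ) (η : ℝ) (k : Fin (F.K η)) : Set 𝕄 :=
  F.part η k.castSucc

/-- The overlap set `S_{K_η+1,η}`. -/
def FineStructure.overlap {μ : Measure 𝕄} (F : FineStructure μ) (η : ℝ) : Set 𝕄 :=
  F.part η (Fin.last (F.K η))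

end Estimator

end

/-! The sampling randomness is confined to one event, on which everything else is deterministic. The
kernel `sqKernel` is at least `n² / 4` within distance `1 / n`, at most `9 n²` everywhere, and
decays like `n² (n ρ)^(-S)` (`IsLowPass.exists_sqKernel_le`, by summation by parts). A sample is
regular if balls of radius `u / n`, `u ≥ 1`, hold at most of order `M u^α n^(-α)` sample points, and
balls of radius `1 / n` centred in the support hold at least of order `M n^(-α)`. Chernoff bounds
and a union bound over a net of `O(n^α)` points show that this fails with probability at most `c₁ /
M^c₂` (`exists_measure_not_isRegularSample_le`).

For a regular sample and `m = n² n^(-α)`, the estimator is at least `(p / 4) m` on the support and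
at most `(H + 9 G) m` everywhere. At distance at least `R / n` from the support it is at most `H
R^(-(S - α)) m`, since dyadic shells give a geometric series (`IsRegularSample.tailSum_le`). For
small `Θ` the support thus passes the threshold, while `R` of order `Θ^(-1/(S - α))` makes all
points farther than `R / n` fail it.

The overlap set is too light to contain, up to a null set, a ball of radius `ρ / n ≤ R / n` about a
support point. Hence every accepted point is within `2 R / n` of a class, and since `2 R / n ≤ η /
2`, the gap `2 η` between classes leaves a gap of at least `η` between their neighbourhoods. -/

noncomputable section

/-! ### Size and decay of the trigonometric kernel. -/

section TrigonometricKernel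

/-- Differencing commutes with differentiation, so the mean value inequality bounds the `s`-th
derivative of `fwdDiff δ g` by `δ * B`. The induction then applies to this new function, which is
why `g` is quantified inside. -/
theorem abs_fwdDiff_iterate_le {δ : ℝ} (hδ : 0 ≤ δ) (s : ℕ) :
    ∀ {g : ℝ → ℝ}, ContDiff ℝ (⊤ : ℕ∞) g → ∀ {B : ℝ}, (∀ x, |iteratedDeriv s g x| ≤ B) →
      ∀ x, |(fwdDiff δ)^[s] g x| ≤ δ ^ s * B := by
  induction s with
  | zero => intro g _ B hB x; simpa using hB x
  | succ s ih =>
    intro g hg B hB x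
    rw [Function.iterate_succ_apply, pow_succ, mul_assoc]
    have hshift : ContDiff ℝ (⊤ : ℕ∞) fun y => g (y + δ) :=
      hg.comp (contDiff_id.add contDiff_const)
    refine ih (hshift.sub hg) (fun y => ?_) x
    have e : iteratedDeriv s (fwdDiff δ g) y =
        iteratedDeriv s g (y + δ) - iteratedDeriv s g y := by
      have h1 : fwdDiff δ g = (fun y => g (y + δ)) - g := rfl
      rw [h1, iteratedDeriv_sub (hshift.of_le (by exact_mod_cast le_top)).contDiffAt
        (hg.of_le (by exact_mod_cast le_top)).contDiffAt, iteratedDeriv_comp_add_const]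
    rw [show iteratedDeriv s (fun x => g (x + δ) - g x) y = _ from e]
    have hd : Differentiable ℝ (iteratedDeriv s g) :=
      hg.differentiable_iteratedDeriv s (by exact_mod_cast ENat.natCast_lt_top s)
    have := Convex.norm_image_sub_le_of_norm_deriv_le (f := iteratedDeriv s g) (C := B)
      (s := Set.univ) (fun z _ => hd z)
      (fun z _ => by rw [← iteratedDeriv_succ]; exact hB z) convex_univ
      (mem_univ y) (mem_univ (y + δ))
    simpa [Real.norm_eq_abs, abs_of_nonneg hδ, mul_comm] using this

theorem fwdDiff_iterate_apply_eq_zero {a : ℤ → ℂ} {p q : ℤ}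
    (ha : ∀ l, l ∉ Finset.Icc p q → a l = 0) (s : ℕ) :
    ∀ l, l ∉ Finset.Icc (p - s) q → (fwdDiff (1 : ℤ))^[s] a l = 0 := by
  induction s with
  | zero => simpa using ha
  | succ s ih =>
    intro l hl
    rw [Function.iterate_succ_apply', fwdDiff, ih, ih, sub_zero] <;>
    · simp only [Finset.mem_Icc] at hl ⊢
      push_cast at hl ⊢
      omega

/-- Summation by parts: multiplying by `exp (-it)` shifts the coefficients by one. Summing over all
of `ℤ` avoids boundary terms, and finite support makes every series summable. -/
theorem pow_mul_tsum_mul_exp (t : ℝ) {a : ℤ → ℂ} {p q : ℤ}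
    (ha : ∀ l, l ∉ Finset.Icc p q → a l = 0) (s : ℕ) :
    (Complex.exp (Complex.I * (-t : ℝ)) - 1) ^ s * ∑' l : ℤ, a l * Complex.exp (Complex.I * l * t)
      = ∑' l : ℤ, (fwdDiff (1 : ℤ))^[s] a l * Complex.exp (Complex.I * l * t) := by
  induction s with
  | zero => simp
  | succ s ih =>
    set b := (fwdDiff (1 : ℤ))^[s] a with hb
    have hb0 : ∀ l, l ∉ Finset.Icc (p - s) q → b l = 0 := fwdDiff_iterate_apply_eq_zero ha s
    have hs1 : Summable fun l : ℤ => b l * Complex.exp (Complex.I * l * t) :=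
      summable_of_ne_finset_zero (s := Finset.Icc (p - s) q) fun l hl => by rw [hb0 l hl, zero_mul]
    have hs2 : Summable fun l : ℤ => b (l + 1) * Complex.exp (Complex.I * l * t) :=
      summable_of_ne_finset_zero (s := Finset.Icc (p - s - 1) q) fun l hl => by
        rw [hb0 (l + 1), zero_mul]
        simp only [Finset.mem_Icc] at hl ⊢
        omega
    have e1 : Complex.exp (Complex.I * (-t : ℝ)) * ∑' l : ℤ, b l * Complex.exp (Complex.I * l * t)
        = ∑' l : ℤ, b (l + 1) * Complex.exp (Complex.I * l * t) := by
      rw [← (Equiv.addRight (1 : ℤ)).tsum_eq, ← tsum_mul_left]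
      refine tsum_congr fun l => ?_
      simp only [Equiv.coe_addRight]
      rw [mul_left_comm, ← Complex.exp_add]
      congr 2
      push_cast
      ring
    rw [pow_succ', mul_assoc, ih, sub_mul, one_mul, e1, ← hs2.tsum_sub hs1]
    refine tsum_congr fun l => ?_
    rw [Function.iterate_succ_apply', ← hb, fwdDiff, sub_mul]

namespace IsLowPass

variable {h : ℝ → ℝ} (hh : IsLowPass h)
include hh

theorem nonneg (t : ℝ) : 0 ≤ h t := by
  have key : ∀ t, 0 ≤ t → 0 ≤ h t := fun t ht => by
    rcases le_total 1 t with h1 | h1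
    · rw [hh.eq_zero t (h1.trans (le_abs_self t))]
    · rw [← hh.eq_zero 1 (by simp)]
      exact hh.antitone ht (by simp : (1 : ℝ) ∈ Ici 0) h1
  rcases le_total 0 t with ht | ht
  · exact key t ht
  · rw [← hh.even]
    exact key _ (by linarith)

theorem apply_abs (t : ℝ) : h |t| = h t := by
  rcases abs_choice t with e | e <;> rw [e]
  exact hh.even t

theorem le_one (t : ℝ) : h t ≤ 1 := by
  rw [← hh.eq_one 0 (by norm_num), ← hh.apply_abs]
  exact hh.antitone (by simp : (0 : ℝ) ∈ Ici 0) (abs_nonneg t) (abs_nonneg t)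

theorem exists_abs_iteratedDeriv_le (s : ℕ) : ∃ B, 0 ≤ B ∧ ∀ x, |iteratedDeriv s h x| ≤ B := by
  have hc : HasCompactSupport h :=
    HasCompactSupport.intro (isCompact_Icc (a := (-1 : ℝ)) (b := 1)) fun x hx => by
      refine hh.eq_zero x ?_
      by_contra hlt
      exact hx (abs_le.1 (not_le.1 hlt).le)
  obtain ⟨B, hB⟩ := (hc.iteratedFDeriv (𝕜 := ℝ) s).exists_bound_of_continuous
    (hh.smooth.continuous_iteratedFDeriv (by exact_mod_cast le_top))
  refine ⟨B, (norm_nonneg _).trans (hB 0), fun x => ?_⟩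
  rw [← Real.norm_eq_abs, ← norm_iteratedFDeriv_eq_norm_iteratedDeriv]
  exact hB x

theorem abs_trigKernel_le {n : ℕ} (hn : 1 ≤ n) (t : ℝ) : |trigKernel h n t| ≤ 3 * n := by
  have hn' : (1 : ℝ) ≤ n := by exact_mod_cast hn
  calc |trigKernel h n t|
      ≤ ∑ l ∈ Finset.Icc (-(n : ℤ)) n, |h (|(l : ℝ)| / n) * Real.cos (l * t)| :=
        Finset.abs_sum_le_sum_abs _ _
    _ ≤ ∑ l ∈ Finset.Icc (-(n : ℤ)) n, (1 : ℝ) := by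
        refine Finset.sum_le_sum fun l _ => ?_
        rw [abs_mul, abs_of_nonneg (hh.nonneg _)]
        exact mul_le_one₀ (hh.le_one _) (abs_nonneg _) (Real.abs_cos_le_one _)
    _ = 2 * n + 1 := by
        rw [Finset.sum_const, Int.card_Icc, nsmul_eq_mul, mul_one,
          show (n + 1 - -(n : ℤ)).toNat = 2 * n + 1 by omega]
        push_cast
        ring
    _ ≤ 3 * n := by linarith

/-- For these `t` every cosine in the sum is at least `1 / 2`, so no term is negative. The indices
`|l| ≤ n / 2`, where the filter is `1`, number `2 ⌊n / 2⌋ + 1 ≥ n`. -/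
theorem le_trigKernel {n : ℕ} (hn : 1 ≤ n) {t : ℝ} (ht : |t| ≤ 1 / n) :
    n / 2 ≤ trigKernel h n t := by
  have hn' : (0 : ℝ) < n := by exact_mod_cast hn
  have hcos : ∀ l ∈ Finset.Icc (-(n : ℤ)) n, 1 / 2 ≤ Real.cos (l * t) := fun l hl => by
    have hl' : |(l : ℝ)| ≤ n := by
      rw [← Int.cast_abs]
      exact_mod_cast abs_le.2 (Finset.mem_Icc.1 hl)
    have h1 : |l * t| ≤ 1 := by
      rw [abs_mul]
      calc |(l : ℝ)| * |t| ≤ n * (1 / n) := by gcongr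
        _ = 1 := by field_simp
    have h2 : (l * t) ^ 2 ≤ 1 := (sq_le_one_iff_abs_le_one _).2 h1
    linarith [Real.one_sub_sq_div_two_le_cos (x := l * t)]
  have hsub : Finset.Icc (-((n / 2 : ℕ) : ℤ)) ((n / 2 : ℕ) : ℤ) ⊆ Finset.Icc (-(n : ℤ)) n := by
    intro l hl
    simp only [Finset.mem_Icc] at hl ⊢
    omega
  calc (n : ℝ) / 2
      ≤ ((2 * (n / 2) + 1 : ℕ) : ℝ) * (1 / 2) := by
        have : (n : ℝ) ≤ ((2 * (n / 2) + 1 : ℕ) : ℝ) := by exact_mod_cast (by omega)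
        linarith
    _ = ∑ l ∈ Finset.Icc (-((n / 2 : ℕ) : ℤ)) ((n / 2 : ℕ) : ℤ), (1 / 2 : ℝ) := by
        rw [Finset.sum_const, Int.card_Icc, nsmul_eq_mul]
        congr 2
        omega
    _ ≤ ∑ l ∈ Finset.Icc (-((n / 2 : ℕ) : ℤ)) ((n / 2 : ℕ) : ℤ),
          h (|(l : ℝ)| / n) * Real.cos (l * t) := by
        refine Finset.sum_le_sum fun l hl => ?_
        rw [hh.eq_one, one_mul]
        · exact hcos l (hsub hl)
        · rw [abs_div, abs_abs, Nat.abs_cast, div_le_iff₀ hn', ← Int.cast_abs]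
          have h1 : |l| ≤ ((n / 2 : ℕ) : ℤ) := abs_le.2 (Finset.mem_Icc.1 hl)
          have h2 : ((2 * |l| : ℤ) : ℝ) ≤ ((n : ℤ) : ℝ) := by exact_mod_cast (by omega)
          push_cast at h2 ⊢
          linarith
    _ ≤ trigKernel h n t :=
        Finset.sum_le_sum_of_subset_of_nonneg hsub fun l hl _ =>
          mul_nonneg (hh.nonneg _) (by linarith [hcos l hl])

/-- Rapid decay of the kernel, by summation by parts `s` times. -/
theorem exists_abs_trigKernel_mul_pow_le (s : ℕ) : ∃ K, 0 < K ∧ ∀ n : ℕ, 1 ≤ n →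
    ∀ t : ℝ, 0 ≤ t → t ≤ Real.pi → |trigKernel h n t| * (n * t) ^ s ≤ K * n := by
  obtain ⟨B, hB0, hB⟩ := hh.exists_abs_iteratedDeriv_le s
  refine ⟨(Real.pi / 2) ^ s * (B * (s + 3)) + 1, by positivity, fun n hn t ht0 htπ => ?_⟩
  have hn' : (0 : ℝ) < n := by exact_mod_cast hn
  have hn1 : (1 : ℝ) ≤ n := by exact_mod_cast hn
  -- By evenness of `h` the absolute value can be dropped: the coefficients sample a smooth function
  -- at spacing `1 / n`, so each difference gains a factor `1 / n`.
  set a : ℤ → ℂ := fun l => ((h (l * (1 / n)) : ℝ) : ℂ) with ha_def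
  have ha : ∀ l, l ∉ Finset.Icc (-(n : ℤ)) n → a l = 0 := fun l hl => by
    have h1 : (n : ℤ) ≤ |l| := by
      by_contra hlt
      exact hl (Finset.mem_Icc.2 (abs_le.1 (not_le.1 hlt).le))
    have h2 : (n : ℝ) ≤ |(l : ℝ)| := by
      rw [← Int.cast_abs]
      exact_mod_cast h1
    rw [ha_def]
    simp only
    rw [hh.eq_zero, Complex.ofReal_zero]
    rw [abs_mul, abs_of_nonneg (by positivity : (0 : ℝ) ≤ 1 / n), mul_one_div, le_div_iff₀ hn']
    linarith
  have hdiff : ∀ l : ℤ, (fwdDiff (1 : ℤ))^[s] a l =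
      (((fwdDiff (1 / n : ℝ))^[s] h (l * (1 / n)) : ℝ) : ℂ) := by
    generalize s = k
    induction k with
    | zero => intro l; rfl
    | succ k ih =>
      intro l
      rw [Function.iterate_succ_apply', Function.iterate_succ_apply', fwdDiff, fwdDiff, ih, ih]
      push_cast
      rw [add_mul, one_mul]
  have hsum : ((trigKernel h n t : ℝ) : ℂ) = ∑' l : ℤ, a l * Complex.exp (Complex.I * l * t) := by
    rw [ofReal_trigKernel, tsum_eq_sum (s := Finset.Icc (-(n : ℤ)) n)
      fun l hl => by rw [ha l hl, zero_mul]]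
    refine Finset.sum_congr rfl fun l _ => ?_
    rw [ha_def]
    simp only
    rw [← hh.apply_abs (l * (1 / n)), abs_mul, abs_of_nonneg (by positivity : (0 : ℝ) ≤ 1 / n),
      mul_one_div]
  -- The norm is `2 sin (t / 2)`, and Jordan's inequality applies because `t ≤ π`.
  have hE : t * (2 / Real.pi) ≤ ‖Complex.exp (Complex.I * (-t : ℝ)) - 1‖ := by
    rw [Complex.norm_exp_I_mul_ofReal_sub_one, neg_div, Real.sin_neg, mul_neg, norm_neg,
      Real.norm_eq_abs]
    refine le_trans ?_ (le_abs_self _)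
    have := Real.mul_le_sin (x := t / 2) (by linarith) (by linarith)
    calc t * (2 / Real.pi) = 2 * (2 / Real.pi * (t / 2)) := by ring
      _ ≤ _ := by gcongr
  have key : |trigKernel h n t| * (t * (2 / Real.pi)) ^ s ≤
      (2 * n + s + 1) * ((1 / n) ^ s * B) := by
    have h1 := pow_mul_tsum_mul_exp t ha s
    rw [← hsum, tsum_eq_sum (s := Finset.Icc (-(n : ℤ) - s) n)
      fun l hl => by rw [fwdDiff_iterate_apply_eq_zero ha s l hl, zero_mul]] at h1
    calc |trigKernel h n t| * (t * (2 / Real.pi)) ^ s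
        ≤ |trigKernel h n t| * ‖Complex.exp (Complex.I * (-t : ℝ)) - 1‖ ^ s := by gcongr
      _ = ‖∑ l ∈ Finset.Icc (-(n : ℤ) - s) n,
            (fwdDiff (1 : ℤ))^[s] a l * Complex.exp (Complex.I * l * t)‖ := by
          rw [← h1, norm_mul, norm_pow, Complex.norm_real, Real.norm_eq_abs, mul_comm]
      _ ≤ ∑ l ∈ Finset.Icc (-(n : ℤ) - s) n, (1 / n : ℝ) ^ s * B := by
          refine (norm_sum_le _ _).trans (Finset.sum_le_sum fun l _ => ?_)
          rw [norm_mul, show Complex.I * l * t = ((l * t : ℝ) : ℂ) * Complex.I by push_cast; ring,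
            Complex.norm_exp_ofReal_mul_I, mul_one, hdiff, Complex.norm_real, Real.norm_eq_abs]
          exact abs_fwdDiff_iterate_le (by positivity) s hh.smooth hB _
      _ = _ := by
          rw [Finset.sum_const, Int.card_Icc, nsmul_eq_mul,
            show (n + 1 - (-(n : ℤ) - s)).toNat = 2 * n + s + 1 by omega]
          push_cast
          ring
  calc |trigKernel h n t| * (n * t) ^ s
      = (|trigKernel h n t| * (t * (2 / Real.pi)) ^ s) * (n ^ s * (Real.pi / 2) ^ s) := by
        rw [mul_assoc, ← mul_pow, ← mul_pow]
        congr 2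
        field_simp
    _ ≤ ((2 * n + s + 1) * ((1 / n) ^ s * B)) * (n ^ s * (Real.pi / 2) ^ s) := by gcongr
    _ = (2 * n + s + 1) * B * (Real.pi / 2) ^ s * ((1 / n) * n) ^ s := by
        rw [mul_pow]
        ring
    _ = (2 * n + s + 1) * B * (Real.pi / 2) ^ s := by
        rw [one_div_mul_cancel hn'.ne', one_pow, mul_one]
    _ ≤ ((s + 3) * n) * B * (Real.pi / 2) ^ s := by
        gcongr
        nlinarith [(Nat.cast_nonneg s : (0 : ℝ) ≤ s)]
    _ ≤ ((Real.pi / 2) ^ s * (B * (s + 3)) + 1) * n := by nlinarith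

end IsLowPass

/-- Rapid decay of the squared kernel, with a real exponent. -/
theorem IsLowPass.exists_sqKernel_le {h : ℝ → ℝ} (hh : IsLowPass h) (S : ℝ) :
    ∃ K, 0 < K ∧ ∀ (𝕄 : Type u) [MetricSpace 𝕄] (n : ℕ) (x y : 𝕄), 1 ≤ n →
      dist x y ≤ Real.pi → 1 ≤ n * dist x y →
        sqKernel h n x y ≤ K * n ^ 2 * (n * dist x y) ^ (-S) := by
  obtain ⟨K, hK, hb⟩ := hh.exists_abs_trigKernel_mul_pow_le ⌈S⌉₊
  refine ⟨K ^ 2, by positivity, fun 𝕄 _ n x y hn hπ h1 => ?_⟩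
  set τ := n * dist x y with hτ
  have hτ0 : 0 < τ := by linarith
  have h2 : |trigKernel h n (dist x y)| * τ ^ ⌈S⌉₊ ≤ K * n := hb n hn _ dist_nonneg hπ
  have h3 : sqKernel h n x y * (τ ^ ⌈S⌉₊ * τ ^ ⌈S⌉₊) ≤ K ^ 2 * n ^ 2 := by
    calc _ = (|trigKernel h n (dist x y)| * τ ^ ⌈S⌉₊) ^ 2 := by
          rw [sqKernel, ← sq_abs]; ring
      _ ≤ (K * n) ^ 2 := by gcongr
      _ = _ := by ring
  -- Squaring the kernel doubles the decay exponent; since `τ ≥ 1`, the surplus is discarded.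
  have h4 : τ ^ S ≤ τ ^ ⌈S⌉₊ * τ ^ ⌈S⌉₊ := by
    calc τ ^ S ≤ τ ^ (⌈S⌉₊ : ℝ) := Real.rpow_le_rpow_of_exponent_le h1 (Nat.le_ceil S)
      _ = τ ^ ⌈S⌉₊ := Real.rpow_natCast _ _
      _ ≤ _ := le_mul_of_one_le_left (by positivity) (one_le_pow₀ h1)
  rw [Real.rpow_neg hτ0.le, ← div_eq_mul_inv, le_div_iff₀ (by positivity)]
  exact (mul_le_mul_of_nonneg_left h4 (sq_nonneg _)).trans h3

end TrigonometricKernel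

/-! ### Chernoff bounds for the number of sample points in a set. -/

section Chernoff

variable {Ω : Type*}

/-- The number of points of the sample `x` in `B`. -/
def sampleCount {M : ℕ} (B : Set Ω) (x : Fin M → Ω) : ℝ :=
  ∑ j, B.indicator (fun _ => (1 : ℝ)) (x j)

theorem sampleCount_mono {M : ℕ} {A B : Set Ω} {x : Fin M → Ω} (h : ∀ j, x j ∈ A → x j ∈ B) :
    sampleCount A x ≤ sampleCount B x := by
  classical
  refine Finset.sum_le_sum fun j _ => ?_
  by_cases hA : x j ∈ A
  · simp [hA, h j hA]
  · simp only [indicator_of_notMem hA]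
    exact indicator_nonneg (fun _ _ => zero_le_one) _

theorem sampleCount_le_sum {M : ℕ} {ι : Type*} (s : Finset ι) {A : Set Ω} {B : ι → Set Ω}
    {x : Fin M → Ω} (h : ∀ j, x j ∈ A → ∃ i ∈ s, x j ∈ B i) :
    sampleCount A x ≤ ∑ i ∈ s, sampleCount (B i) x := by
  classical
  unfold sampleCount
  rw [Finset.sum_comm]
  have h0 : ∀ j i, 0 ≤ (B i).indicator (fun _ => (1 : ℝ)) (x j) :=
    fun j i => indicator_nonneg (fun _ _ => zero_le_one) _
  refine Finset.sum_le_sum fun j _ => ?_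
  by_cases hA : x j ∈ A
  · obtain ⟨i, hi, hB⟩ := h j hA
    rw [indicator_of_mem hA]
    calc (1 : ℝ) = (B i).indicator (fun _ => (1 : ℝ)) (x j) := by rw [indicator_of_mem hB]
      _ ≤ _ := Finset.single_le_sum (f := fun i => (B i).indicator (fun _ => (1 : ℝ)) (x j))
        (fun i _ => h0 j i) hi
  · rw [indicator_of_notMem hA]
    exact Finset.sum_nonneg fun i _ => h0 j i

theorem abs_sampleCount_le {M : ℕ} (B : Set Ω) (x : Fin M → Ω) : |sampleCount B x| ≤ M := by
  classical
  refine (Finset.abs_sum_le_sum_abs _ _).trans ?_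
  calc _ ≤ ∑ _j : Fin M, (1 : ℝ) := Finset.sum_le_sum fun j _ => by
        by_cases h : x j ∈ B <;> simp [h]
    _ = M := by simp

variable [MeasurableSpace Ω] {μ : Measure Ω} [IsProbabilityMeasure μ] {M : ℕ} {B : Set Ω}

theorem measurable_sampleCount (hB : MeasurableSet B) :
    Measurable (sampleCount B : (Fin M → Ω) → ℝ) :=
  Finset.measurable_sum _ fun j _ => (measurable_const.indicator hB).comp (measurable_pi_apply j)

theorem integrable_exp_mul_sampleCount (hB : MeasurableSet B) (s : ℝ) :
    Integrable (fun x => Real.exp (s * sampleCount B x)) (Measure.pi fun _ : Fin M => μ) := by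
  refine Integrable.of_bound (C := Real.exp (|s| * M))
    ((measurable_sampleCount hB).const_mul s).exp.aestronglyMeasurable (ae_of_all _ fun x => ?_)
  rw [Real.norm_eq_abs, Real.abs_exp, Real.exp_le_exp]
  refine (le_abs_self _).trans ?_
  rw [abs_mul]
  gcongr
  exact abs_sampleCount_le B x

/-- Independence factors the moment generating function, and `1 + v ≤ exp v` compares each factor
with the Poisson one. -/
theorem mgf_sampleCount_le (hB : MeasurableSet B) (s : ℝ) :
    ProbabilityTheory.mgf (sampleCount B) (Measure.pi fun _ : Fin M => μ) s ≤
      Real.exp (M * (μ.real B * (Real.exp s - 1))) := by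
  classical
  have e : ∀ y, Real.exp (s * B.indicator (fun _ => (1 : ℝ)) y) =
      1 + B.indicator (fun _ => Real.exp s - 1) y := fun y => by
    by_cases h : y ∈ B <;> simp [h]
  have h1 : ∫ y, Real.exp (s * B.indicator (fun _ => (1 : ℝ)) y) ∂μ =
      1 + μ.real B * (Real.exp s - 1) := by
    simp_rw [e]
    rw [integral_add (integrable_const _) ((integrable_const _).indicator hB),
      integral_indicator_const _ hB]
    simp
  have h0 : 0 ≤ ∫ y, Real.exp (s * B.indicator (fun _ => (1 : ℝ)) y) ∂μ :=
    integral_nonneg fun y => (Real.exp_pos _).le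
  unfold ProbabilityTheory.mgf sampleCount
  simp_rw [Finset.mul_sum, Real.exp_sum]
  rw [integral_fintype_prod_eq_prod (𝕜 := ℝ)
    (f := fun _ y => Real.exp (s * B.indicator (fun _ => (1 : ℝ)) y)), Finset.prod_const,
    Finset.card_univ, Fintype.card_fin, Real.exp_nat_mul]
  refine pow_le_pow_left₀ h0 ?_ M
  rw [h1, add_comm]
  exact Real.add_one_le_exp _

/-- Exponential Markov at parameter `1`: the exponent is at most `-3 M q + (e - 1) M q`, and `e - 1
≤ 2`. -/
theorem measure_le_sampleCount_le (hB : MeasurableSet B) {q : ℝ} (hq : μ.real B ≤ q) :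
    (Measure.pi fun _ : Fin M => μ).real {x | 3 * (M * q) ≤ sampleCount B x} ≤
      Real.exp (-(M * q)) := by
  refine (ProbabilityTheory.measure_ge_le_exp_mul_mgf _ zero_le_one
    (integrable_exp_mul_sampleCount hB 1)).trans ?_
  refine (mul_le_mul_of_nonneg_left (mgf_sampleCount_le hB 1) (Real.exp_pos _).le).trans ?_
  rw [← Real.exp_add, Real.exp_le_exp]
  have h2 : μ.real B * (Real.exp 1 - 1) ≤ q * 2 :=
    mul_le_mul hq (by linarith [Real.exp_one_lt_d9]) (by linarith [Real.exp_one_gt_d9])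
      (measureReal_nonneg.trans hq)
  nlinarith [mul_le_mul_of_nonneg_left h2 (Nat.cast_nonneg M : (0 : ℝ) ≤ M)]

/-- Exponential Markov at parameter `-1`: the exponent is at most `M p / 4 - M p / 2`, because `1 -
1 / e ≥ 1 / 2`. -/
theorem measure_sampleCount_le_le (hB : MeasurableSet B) {p : ℝ} (hp : p ≤ μ.real B) :
    (Measure.pi fun _ : Fin M => μ).real {x | sampleCount B x ≤ M * p / 4} ≤
      Real.exp (-(M * p) / 4) := by
  refine (ProbabilityTheory.measure_le_le_exp_mul_mgf _ (by norm_num : (-1 : ℝ) ≤ 0)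
    (integrable_exp_mul_sampleCount hB (-1))).trans ?_
  refine (mul_le_mul_of_nonneg_left (mgf_sampleCount_le hB (-1)) (Real.exp_pos _).le).trans ?_
  rw [← Real.exp_add, Real.exp_le_exp]
  have h2 : μ.real B * (Real.exp (-1) - 1) ≤ p * (-1 / 2) := by
    have h3 := Real.exp_neg_one_lt_d9
    nlinarith [measureReal_nonneg (μ := μ) (s := B)]
  nlinarith [mul_le_mul_of_nonneg_left h2 (Nat.cast_nonneg M : (0 : ℝ) ≤ M)]

end Chernoff

/-! ### Nets, packing bounds and the probability of a regular sample. -/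

section Net

theorem div_natCast_rpow {a : ℝ} (ha : 0 ≤ a) (n : ℕ) (α : ℝ) :
    (a / n) ^ α = a ^ α * (n : ℝ) ^ (-α) := by
  rw [Real.div_rpow ha (Nat.cast_nonneg n), Real.rpow_neg (Nat.cast_nonneg n), div_eq_mul_inv]

variable {𝕄 : Type*} [MetricSpace 𝕄]

theorem dist_le_of_diam_univ [CompactSpace 𝕄] {D : ℝ} (hD : Metric.diam (univ : Set 𝕄) = D)
    (x y : 𝕄) : dist x y ≤ D :=
  hD ▸ Metric.dist_le_diam_of_mem isCompact_univ.isBounded (mem_univ x) (mem_univ y)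

/-- A separated set of maximal cardinality is a net, since an uncovered point could be added. The
bound `b` makes the maximum exist. -/
theorem exists_separated_net {X : Set 𝕄} {δ : ℝ} (hδ : 0 ≤ δ) {b : ℕ}
    (hb : ∀ N : Finset 𝕄, ↑N ⊆ X → (N : Set 𝕄).Pairwise (fun v w => δ < dist v w) → N.card ≤ b) :
    ∃ N : Finset 𝕄, ↑N ⊆ X ∧ (N : Set 𝕄).Pairwise (fun v w => δ < dist v w) ∧
      ∀ z ∈ X, ∃ w ∈ N, dist z w ≤ δ := by
  classical
  set P : Set ℕ := {k | ∃ N : Finset 𝕄, ↑N ⊆ X ∧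
    (N : Set 𝕄).Pairwise (fun v w => δ < dist v w) ∧ N.card = k} with hP
  have hbdd : BddAbove P := ⟨b, by rintro k ⟨N, h1, h2, rfl⟩; exact hb N h1 h2⟩
  obtain ⟨N, h1, h2, h3⟩ : sSup P ∈ P := Nat.sSup_mem ⟨0, ∅, by simp⟩ hbdd
  refine ⟨N, h1, h2, fun z hz => ?_⟩
  by_contra! hfar
  have hzN : z ∉ N := fun hmem => by
    have := hfar z hmem
    rw [dist_self] at this
    exact hδ.not_gt this
  have hmem : (insert z N).card ∈ P := by
    refine ⟨insert z N, ?_, ?_, rfl⟩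
    · rw [Finset.coe_insert]
      exact insert_subset hz h1
    · rw [Finset.coe_insert]
      refine h2.insert fun w hw _ => ⟨hfar w hw, ?_⟩
      rw [dist_comm]
      exact hfar w hw
  have := le_csSup hbdd hmem
  rw [Finset.card_insert_of_notMem hzN] at this
  omega

variable [MeasurableSpace 𝕄] {μ : Measure 𝕄} {α κ₁ κ₂ r₀ : ℝ}

namespace IsDetectable

theorem measureReal_closedBall_le [IsProbabilityMeasure μ] (hμ : IsDetectable μ α κ₁ κ₂ r₀)
    (hα : 0 ≤ α) (hκ₁ : 0 < κ₁) (hdist : ∀ x y : 𝕄, dist x y ≤ Real.pi) (x : 𝕄) {r : ℝ}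
    (hr : 0 < r) : μ.real (Metric.closedBall x r) ≤ κ₁ * r ^ α := by
  rcases le_total r Real.pi with h | h
  · exact hμ.upper x r hr h
  · have huniv : Metric.closedBall x Real.pi = univ := eq_univ_of_forall fun y => hdist y x
    calc μ.real (Metric.closedBall x r) ≤ 1 := measureReal_le_one
      _ = μ.real (Metric.closedBall x Real.pi) := by rw [huniv, probReal_univ]
      _ ≤ κ₁ * Real.pi ^ α := hμ.upper x _ Real.pi_pos le_rfl
      _ ≤ κ₁ * r ^ α := by
        have := Real.rpow_le_rpow Real.pi_pos.le h hα
        gcongr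

variable [BorelSpace 𝕄]

/-- Volume packing: balls of half the separation are disjoint, and each has mass bounded below. -/
theorem card_mul_le [IsFiniteMeasure μ] (hμ : IsDetectable μ α κ₁ κ₂ r₀) {δ : ℝ} (hδ : 0 < δ)
    (hδr : δ / 2 ≤ r₀) {N : Finset 𝕄} (hN : ↑N ⊆ μ.support)
    (hsep : (N : Set 𝕄).Pairwise (fun v w => δ < dist v w)) {A : Set 𝕄}
    (hA : ∀ w ∈ N, Metric.closedBall w (δ / 2) ⊆ A) :
    N.card * (κ₂ * (δ / 2) ^ α) ≤ μ.real A := by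
  calc N.card * (κ₂ * (δ / 2) ^ α) = ∑ _w ∈ N, κ₂ * (δ / 2) ^ α := by
        rw [Finset.sum_const, nsmul_eq_mul]
    _ ≤ ∑ w ∈ N, μ.real (Metric.closedBall w (δ / 2)) :=
        Finset.sum_le_sum fun w hw => hμ.lower w (hN hw) _ (by positivity) hδr
    _ = μ.real (⋃ w ∈ N, Metric.closedBall w (δ / 2)) := by
        refine (measureReal_biUnion_finset (fun v hv w hw hvw => ?_)
          (fun w _ => Metric.isClosed_closedBall.measurableSet)).symm
        exact Metric.closedBall_disjoint_closedBall (by linarith [hsep hv hw hvw])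
    _ ≤ μ.real A := measureReal_mono (iUnion₂_subset hA)

end IsDetectable

/-- A sample whose empirical measure behaves like a detectable measure at scales from `1/n` on. -/
structure IsRegularSample (μ : Measure 𝕄) (α p G : ℝ) (n : ℕ) {M : ℕ} (x : Fin M → 𝕄) : Prop where
  mem : ∀ j, x j ∈ μ.support
  lower : ∀ z ∈ μ.support,
    M * (p * (n : ℝ) ^ (-α)) ≤ sampleCount (Metric.closedBall z (1 / n)) x
  upper : ∀ (z : 𝕄) (u : ℝ), 1 ≤ u →
    sampleCount (Metric.closedBall z (u / n)) x ≤ M * (G * u ^ α * (n : ℝ) ^ (-α))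

/-- With `T = M n^(-α)`, half of the exponent `c T` absorbs `n^α`, as `α log n ≤ c T / 2`. The other
half is a negative power of `M`, as `log M = log T + α log n ≤ (1 + c / 2) T`. -/
theorem rpow_mul_exp_le {α c : ℝ} (hα : 0 ≤ α) (hc : 0 < c) {n M : ℕ} (hn : 1 ≤ n) (hM : 1 ≤ M)
    (h : (2 * α / c + 1) * ((n : ℝ) ^ α * Real.log n) ≤ M) :
    (n : ℝ) ^ α * Real.exp (-(c * (M * (n : ℝ) ^ (-α)))) ≤
      1 / (M : ℝ) ^ (c / 2 / (1 + c / 2)) := by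
  have hn0 : (0 : ℝ) < n := by exact_mod_cast hn
  have hM0 : (0 : ℝ) < M := by exact_mod_cast hM
  have hlog : 0 ≤ Real.log n := Real.log_natCast_nonneg n
  set T : ℝ := M * (n : ℝ) ^ (-α) with hT
  have hT0 : 0 < T := by positivity
  have h1 : (2 * α / c + 1) * Real.log n ≤ T := by
    calc (2 * α / c + 1) * Real.log n
        = ((2 * α / c + 1) * ((n : ℝ) ^ α * Real.log n)) * (n : ℝ) ^ (-α) := by
          rw [Real.rpow_neg hn0.le]
          field_simp
      _ ≤ T := by rw [hT]; gcongr
  have h2 : α * Real.log n ≤ c / 2 * T := by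
    calc α * Real.log n = c / 2 * (2 * α / c * Real.log n) := by field_simp
      _ ≤ c / 2 * T := by
        gcongr
        linarith
  have h3 : Real.log M ≤ (1 + c / 2) * T := by
    have e : Real.log T = Real.log M - α * Real.log n := by
      rw [hT, Real.log_mul hM0.ne' (by positivity), Real.log_rpow hn0]
      ring
    linarith [Real.log_le_sub_one_of_pos hT0]
  rw [one_div, ← Real.rpow_neg hM0.le, Real.rpow_def_of_pos hM0, Real.rpow_def_of_pos hn0,
    ← Real.exp_add, Real.exp_le_exp]
  have h4 : c / 2 / (1 + c / 2) * Real.log M ≤ c / 2 * T := by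
    calc _ ≤ c / 2 / (1 + c / 2) * ((1 + c / 2) * T) := by gcongr
      _ = c / 2 * T := by field_simp
  linarith

end Net

/-- Two bad events for each point of a net of the support suffice: too many samples at radius `1 /
n`, or too few at radius `δ`. A ball of radius `1 / n` about a support point contains a net ball of
radius `δ`. The samples in a ball of radius `u / n` are covered by `O(u^α)` net balls of radius `1 /
n`. -/
theorem exists_measure_not_isRegularSample_le {α κ₁ κ₂ r₀ : ℝ} (hα : 0 ≤ α) (hκ₁ : 0 < κ₁)
    (hκ₂ : 0 < κ₂) (hr₀ : 0 < r₀) :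
    ∃ p G A₁ c₁ c₂ : ℝ, 0 < p ∧ 0 < G ∧ 0 < A₁ ∧ 0 < c₁ ∧ 0 < c₂ ∧
    ∀ (𝕄 : Type u) [MetricSpace 𝕄] [CompactSpace 𝕄] [MeasurableSpace 𝕄] [BorelSpace 𝕄],
      Metric.diam (univ : Set 𝕄) = Real.pi →
    ∀ (μ : Measure 𝕄) [IsProbabilityMeasure μ], IsDetectable μ α κ₁ κ₂ r₀ →
    ∀ n M : ℕ, 1 ≤ n → 1 ≤ M → A₁ * ((n : ℝ) ^ α * Real.log n) ≤ M →
      Measure.pi (fun _ : Fin M => μ) {x : Fin M → 𝕄 | ¬ IsRegularSample μ α p G n x}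
        ≤ ENNReal.ofReal (c₁ / (M : ℝ) ^ c₂) := by
  set ρ := min 1 r₀ with hρ
  have hρ0 : 0 < ρ := lt_min one_pos hr₀
  have hρ1 : ρ ≤ 1 := min_le_left _ _
  set a := κ₂ * (ρ / 2) ^ α with ha
  set b := κ₂ * (ρ / 4) ^ α with hb
  have ha0 : 0 < a := by positivity
  have hb0 : 0 < b := by positivity
  -- The smaller of the two Chernoff rates; `a` and `b` bound ball masses from below at radii `δ`
  -- and `δ / 2`.
  set c := min κ₁ (a / 4) with hc
  have hc0 : 0 < c := lt_min hκ₁ (by positivity)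
  refine ⟨a / 4, κ₁ * 3 ^ α / b * (3 * κ₁), 2 * α / c + 1, 2 / b, c / 2 / (1 + c / 2),
    by positivity, by positivity, by positivity, by positivity, by positivity, ?_⟩
  intro 𝕄 _ _ _ _ hdiam μ _ hμ n M hn hM hMn
  have hdist := dist_le_of_diam_univ hdiam
  have hn0 : (0 : ℝ) < n := by exact_mod_cast hn
  have hn1 : (1 : ℝ) ≤ n := by exact_mod_cast hn
  have hM0 : (0 : ℝ) < M := by exact_mod_cast hM
  set m := (n : ℝ) ^ (-α) with hm
  have hm0 : 0 < m := by positivity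
  set δ := ρ / 2 / n with hδ
  have hδ0 : 0 < δ := by positivity
  have hδn : δ ≤ 1 / 2 / n := by rw [hδ]; gcongr
  have h2n : 1 / 2 / (n : ℝ) + 1 / 2 / n = 1 / n := by ring
  have hδr : δ ≤ r₀ := by
    calc δ ≤ ρ / 2 := div_le_self (by positivity) hn1
      _ ≤ r₀ := by linarith [min_le_right 1 r₀]
  have hδα : κ₂ * δ ^ α = a * m := by
    rw [hδ, div_natCast_rpow (by positivity), ← mul_assoc]
  have hδ2α : κ₂ * (δ / 2) ^ α = b * m := by
    rw [show δ / 2 = ρ / 4 / n by rw [hδ]; ring, div_natCast_rpow (by positivity), ← mul_assoc]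
  have hcard : ∀ N : Finset 𝕄, ↑N ⊆ μ.support →
      (N : Set 𝕄).Pairwise (fun v w => δ < dist v w) → (N.card : ℝ) ≤ 1 / b * (n : ℝ) ^ α := by
    intro N h1 h2
    have h3 := hμ.card_mul_le hδ0 (by linarith) h1 h2 (A := univ) fun _ _ => subset_univ _
    rw [hδ2α, probReal_univ, ← le_div_iff₀ (by positivity)] at h3
    refine h3.trans_eq ?_
    rw [hm, Real.rpow_neg hn0.le]
    field_simp
  obtain ⟨N, hNX, hsep, hnet⟩ := exists_separated_net (X := μ.support) hδ0.le
    (b := ⌊1 / b * (n : ℝ) ^ α⌋₊) fun N h1 h2 => Nat.le_floor (hcard N h1 h2)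
  set P := Measure.pi fun _ : Fin M => μ with hP
  set E₁ : 𝕄 → Set (Fin M → 𝕄) :=
    fun w => {x | 3 * (M * (κ₁ * m)) ≤ sampleCount (Metric.closedBall w (1 / n)) x} with hE₁
  set E₂ : 𝕄 → Set (Fin M → 𝕄) :=
    fun w => {x | sampleCount (Metric.closedBall w δ) x ≤ M * (a * m) / 4} with hE₂
  have hsub : ∀ᵐ x ∂P, x ∈ {x | ¬ IsRegularSample μ α (a / 4) (κ₁ * 3 ^ α / b * (3 * κ₁)) n x} →
      x ∈ ⋃ w ∈ N, (E₁ w ∪ E₂ w) := by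
    have hae : ∀ᵐ x ∂P, ∀ j, x j ∈ μ.support := ae_all_iff.2 fun j =>
      (Measure.tendsto_eval_ae_ae (μ := fun _ : Fin M => μ) (i := j)).eventually
        Measure.support_mem_ae
    filter_upwards [hae] with x hx hbad
    by_contra hgood
    simp only [mem_iUnion, mem_union, not_exists, not_or] at hgood
    refine hbad ⟨hx, fun z hz => ?_, fun z u hu => ?_⟩
    · obtain ⟨w, hw, hzw⟩ := hnet z hz
      have h1 : M * (a * m) / 4 < sampleCount (Metric.closedBall w δ) x :=
        not_le.1 (hgood w hw).2
      calc M * (a / 4 * m) = M * (a * m) / 4 := by ring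
        _ ≤ sampleCount (Metric.closedBall w δ) x := h1.le
        _ ≤ _ := sampleCount_mono fun j hj => by
          rw [Metric.mem_closedBall] at hj ⊢
          linarith [dist_triangle_right (x j) z w]
    · classical
      -- Only these net points are needed. Their packing balls lie in the ball of radius `3 u / n`,
      -- because `u ≥ 1`, so their number is at most a constant times `u^α`.
      set N' := N.filter fun w => dist w z ≤ (u + 1) / n with hN'
      have h1 : sampleCount (Metric.closedBall z (u / n)) x ≤
          ∑ w ∈ N', sampleCount (Metric.closedBall w (1 / n)) x := by
        refine sampleCount_le_sum _ fun j hj => ?_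
        obtain ⟨w, hw, hjw⟩ := hnet (x j) (hx j)
        rw [Metric.mem_closedBall] at hj
        have h2 : dist (x j) w ≤ 1 / n := by linarith
        refine ⟨w, Finset.mem_filter.2 ⟨hw, ?_⟩, h2⟩
        rw [add_div]
        linarith [dist_triangle_left w z (x j)]
      have h2 : ∑ w ∈ N', sampleCount (Metric.closedBall w (1 / n)) x ≤
          N'.card * (3 * (M * (κ₁ * m))) := by
        rw [← nsmul_eq_mul, ← Finset.sum_const]
        exact Finset.sum_le_sum fun w hw => (not_le.1 (hgood w (Finset.mem_filter.1 hw).1).1).le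
      have h3 : N'.card * (b * m) ≤ κ₁ * (3 ^ α * u ^ α * m) := by
        rw [← hδ2α]
        refine (hμ.card_mul_le hδ0 (by linarith)
          ((Finset.coe_subset.2 (Finset.filter_subset _ _)).trans hNX)
          (hsep.mono (Finset.coe_subset.2 (Finset.filter_subset _ _)))
          (A := Metric.closedBall z (3 * u / n)) fun w hw => ?_).trans ?_
        · refine Metric.closedBall_subset_closedBall' ?_
          have h4 := (Finset.mem_filter.1 hw).2
          have h5 : (u + 1) / n + 1 / n ≤ 3 * u / n := by
            rw [← add_div]
            gcongr
            linarith
          linarith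
        · refine (hμ.measureReal_closedBall_le hα hκ₁ hdist z (by positivity)).trans_eq ?_
          rw [div_natCast_rpow (by positivity), Real.mul_rpow (by norm_num) (by linarith)]
      have h4 : (N'.card : ℝ) ≤ κ₁ * 3 ^ α / b * u ^ α := by
        rw [← mul_le_mul_iff_left₀ (by positivity : 0 < b * m)]
        refine h3.trans_eq ?_
        field_simp
      calc _ ≤ N'.card * (3 * (M * (κ₁ * m))) := h1.trans h2
        _ ≤ (κ₁ * 3 ^ α / b * u ^ α) * (3 * (M * (κ₁ * m))) := by gcongr
        _ = _ := by ring
  have hball : ∀ w r, MeasurableSet (Metric.closedBall (w : 𝕄) r) :=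
    fun w r => Metric.isClosed_closedBall.measurableSet
  have hE : ∀ w ∈ N, P.real (E₁ w ∪ E₂ w) ≤ 2 * Real.exp (-(c * (M * m))) := by
    intro w hw
    have h1 : P.real (E₁ w) ≤ Real.exp (-(M * (κ₁ * m))) := by
      refine measure_le_sampleCount_le (hball _ _) ?_
      refine (hμ.measureReal_closedBall_le hα hκ₁ hdist w (by positivity)).trans_eq ?_
      rw [div_natCast_rpow zero_le_one, Real.one_rpow, one_mul]
    have h2 : P.real (E₂ w) ≤ Real.exp (-(M * (a * m)) / 4) :=
      measure_sampleCount_le_le (hball _ _) (hδα ▸ hμ.lower w (hNX hw) δ hδ0 hδr)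
    have h3 : Real.exp (-(M * (κ₁ * m))) ≤ Real.exp (-(c * (M * m))) := by
      rw [Real.exp_le_exp, neg_le_neg_iff, show M * (κ₁ * m) = κ₁ * (M * m) by ring]
      gcongr
      exact min_le_left _ _
    have h4 : Real.exp (-(M * (a * m)) / 4) ≤ Real.exp (-(c * (M * m))) := by
      rw [Real.exp_le_exp, neg_div, neg_le_neg_iff,
        show M * (a * m) / 4 = a / 4 * (M * m) by ring]
      gcongr
      exact min_le_right _ _
    linarith [measureReal_union_le (μ := P) (E₁ w) (E₂ w)]
  calc P {x | ¬ IsRegularSample μ α (a / 4) (κ₁ * 3 ^ α / b * (3 * κ₁)) n x}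
      ≤ P (⋃ w ∈ N, (E₁ w ∪ E₂ w)) := measure_mono_ae hsub
    _ = ENNReal.ofReal (P.real (⋃ w ∈ N, (E₁ w ∪ E₂ w))) :=
      (ofReal_measureReal (h := measure_ne_top _ _)).symm
    _ ≤ _ := by
      refine ENNReal.ofReal_le_ofReal ?_
      calc P.real (⋃ w ∈ N, (E₁ w ∪ E₂ w)) ≤ ∑ w ∈ N, P.real (E₁ w ∪ E₂ w) :=
            measureReal_biUnion_finset_le _ _
        _ ≤ N.card * (2 * Real.exp (-(c * (M * m)))) := by
            rw [← nsmul_eq_mul, ← Finset.sum_const]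
            exact Finset.sum_le_sum hE
        _ ≤ (1 / b * (n : ℝ) ^ α) * (2 * Real.exp (-(c * (M * m)))) := by
            gcongr
            exact hcard N hNX hsep
        _ = 2 / b * ((n : ℝ) ^ α * Real.exp (-(c * (M * m)))) := by ring
        _ ≤ 2 / b * (1 / (M : ℝ) ^ (c / 2 / (1 + c / 2))) := by
            gcongr
            exact rpow_mul_exp_le hα hc0 hn hM hMn
        _ = _ := by ring

/-! ### Bounds for the estimator on a regular sample. -/

section SupportEstimates

variable {𝕄 : Type u} [MetricSpace 𝕄] {h : ℝ → ℝ}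

theorem IsLowPass.sqKernel_le (hh : IsLowPass h) {n : ℕ} (hn : 1 ≤ n) (x y : 𝕄) :
    sqKernel h n x y ≤ 9 * n ^ 2 := by
  rw [sqKernel, ← sq_abs]
  calc |trigKernel h n (dist x y)| ^ 2 ≤ (3 * n) ^ 2 := by
        have := hh.abs_trigKernel_le hn (dist x y)
        gcongr
    _ = _ := by ring

theorem IsLowPass.le_sqKernel (hh : IsLowPass h) {n : ℕ} (hn : 1 ≤ n) {x y : 𝕄}
    (hxy : dist x y ≤ 1 / n) : (n : ℝ) ^ 2 / 4 ≤ sqKernel h n x y := by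
  rw [sqKernel]
  calc (n : ℝ) ^ 2 / 4 = (n / 2) ^ 2 := by ring
    _ ≤ _ := by
      have := hh.le_trigKernel hn (t := dist x y) (by rwa [abs_of_nonneg dist_nonneg])
      gcongr

theorem subset_supportSet {n M : ℕ} [Nonempty (Fin M)] {x : Fin M → 𝕄} {X : Set 𝕄}
    {Θ L U : ℝ} (hΘ : 0 ≤ Θ)
    (hU : ∀ z, supportFn h n x z ≤ U) (hL : ∀ z ∈ X, L ≤ supportFn h n x z) (hUL : Θ * U ≤ L) :
    X ⊆ supportSet h n x Θ := fun z hz => by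
  refine le_trans ?_ (hUL.trans (hL z hz))
  have := ciSup_le (f := fun k => supportFn h n x (x k)) fun k => hU (x k)
  gcongr

theorem mul_le_supportFn_of_mem_supportSet {n M : ℕ} {x : Fin M → 𝕄}
    {Θ L : ℝ} (hΘ : 0 ≤ Θ) (j : Fin M)
    (hL : L ≤ supportFn h n x (x j)) {z : 𝕄} (hz : z ∈ supportSet h n x Θ) :
    Θ * L ≤ supportFn h n x z := by
  refine le_trans ?_ hz
  have := hL.trans (le_ciSup (f := fun k => supportFn h n x (x k)) (finite_range _).bddAbove j)
  gcongr

/-- The part of `∑ j, Ψ_n(z, x_j)` that comes from sample points at distance at least `R / n`. -/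
def tailSum (h : ℝ → ℝ) (n : ℕ) {M : ℕ} (x : Fin M → 𝕄) (R : ℝ) (z : 𝕄) : ℝ :=
  ∑ j, {y | R ≤ n * dist z y}.indicator (sqKernel h n z) (x j)

variable [MeasurableSpace 𝕄] {μ : Measure 𝕄} {α p G : ℝ} {n M : ℕ} {x : Fin M → 𝕄}

/-- On the shell where `n ρ` lies between `2^i R` and `2^(i+1) R`, kernel decay times sample count
is of order `(2^i R)^(-(S - α))`. These bounds form a geometric series with ratio `q = 2^(-(S - α))
< 1`. -/
theorem IsRegularSample.tailSum_le (hx : IsRegularSample μ α p G n x)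
    (hdist : ∀ y z : 𝕄, dist y z ≤ Real.pi) (hn : 1 ≤ n) {S K : ℝ} (hS : α < S) (hS0 : 0 ≤ S)
    (hK : 0 < K) (hG : 0 < G)
    (hker : ∀ y z : 𝕄, 1 ≤ n * dist y z →
      sqKernel h n y z ≤ K * n ^ 2 * (n * dist y z) ^ (-S))
    {R : ℝ} (hR : 1 ≤ R) (z : 𝕄) :
    tailSum h n x R z ≤ M * (K * G * 2 ^ α * (1 - 2 ^ (-(S - α)))⁻¹ * (n ^ 2 * (n : ℝ) ^ (-α)) *
      R ^ (-(S - α))) := by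
  have hn0 : (0 : ℝ) < n := by exact_mod_cast hn
  have hR0 : 0 < R := by linarith
  set m := (n : ℝ) ^ (-α) with hm
  set q : ℝ := 2 ^ (-(S - α)) with hq
  have hq0 : 0 < q := by positivity
  have hq1 : q < 1 := Real.rpow_lt_one_of_one_lt_of_neg (by norm_num) (by linarith)
  -- Finitely many shells suffice, because distances are at most `π`.
  obtain ⟨I, hI⟩ := pow_unbounded_of_one_lt (n * Real.pi) (one_lt_two (α := ℝ))
  have hpt : ∀ y : 𝕄, {y | R ≤ n * dist z y}.indicator (sqKernel h n z) y ≤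
      ∑ i ∈ Finset.range I, K * n ^ 2 * (2 ^ i * R) ^ (-S) *
        (Metric.closedBall z (2 ^ (i + 1) * R / n)).indicator (fun _ => (1 : ℝ)) y := by
    intro y
    have hterm : ∀ i ∈ Finset.range I, 0 ≤ K * n ^ 2 * (2 ^ i * R) ^ (-S) *
        (Metric.closedBall z (2 ^ (i + 1) * R / n)).indicator (fun _ => (1 : ℝ)) y :=
      fun i _ => mul_nonneg (by positivity) (indicator_nonneg (fun _ _ => zero_le_one) _)
    by_cases hy : R ≤ n * dist z y
    · rw [indicator_of_mem (show y ∈ {y | R ≤ n * dist z y} from hy)]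
      obtain ⟨i, hi1, hi2⟩ := exists_nat_pow_near ((one_le_div hR0).2 hy) (one_lt_two (α := ℝ))
      have hiI : i < I := by
        refine (pow_lt_pow_iff_right₀ (one_lt_two (α := ℝ))).1 (hi1.trans_lt ?_)
        calc n * dist z y / R ≤ n * dist z y := div_le_self (by positivity) hR
          _ ≤ n * Real.pi := by gcongr; exact hdist z y
          _ < 2 ^ I := hI
      rw [le_div_iff₀ hR0] at hi1
      rw [div_lt_iff₀ hR0] at hi2
      have hyb : y ∈ Metric.closedBall z (2 ^ (i + 1) * R / n) := by
        rw [Metric.mem_closedBall, dist_comm, le_div_iff₀ hn0, mul_comm]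
        exact hi2.le
      calc sqKernel h n z y ≤ K * n ^ 2 * (n * dist z y) ^ (-S) := hker z y (hR.trans hy)
        _ ≤ K * n ^ 2 * (2 ^ i * R) ^ (-S) := by
          gcongr ?_ * ?_
          exact Real.rpow_le_rpow_of_nonpos (by positivity) hi1 (by linarith)
        _ = K * n ^ 2 * (2 ^ i * R) ^ (-S) *
            (Metric.closedBall z (2 ^ (i + 1) * R / n)).indicator (fun _ => (1 : ℝ)) y := by
          rw [indicator_of_mem hyb, mul_one]
        _ ≤ _ := Finset.single_le_sum hterm (Finset.mem_range.2 hiI)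
    · rw [indicator_of_notMem (show y ∉ {y | R ≤ n * dist z y} from hy)]
      exact Finset.sum_nonneg hterm
  have hgeom : ∑ i ∈ Finset.range I, q ^ i ≤ (1 - q)⁻¹ := by
    rw [← tsum_geometric_of_lt_one hq0.le hq1]
    exact (summable_geometric_of_lt_one hq0.le hq1).sum_le_tsum _ fun i _ => by positivity
  have hscale : ∀ i : ℕ, (2 ^ i * R) ^ (-S) * (2 ^ (i + 1) * R) ^ α =
      2 ^ α * R ^ (-(S - α)) * q ^ i := by
    intro i
    have e1 : (2 ^ (i + 1) * R) ^ α = 2 ^ α * (2 ^ i * R) ^ α := by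
      rw [← Real.mul_rpow (by norm_num) (by positivity)]
      congr 1
      ring
    have e2 : q ^ i = (2 ^ i) ^ (-(S - α)) := by
      rw [hq, ← Real.rpow_natCast, ← Real.rpow_mul (by norm_num), mul_comm, Real.rpow_mul (by norm_num),
        Real.rpow_natCast]
    rw [e1, mul_left_comm, ← Real.rpow_add (by positivity), show -S + α = -(S - α) by ring,
      Real.mul_rpow (by positivity) hR0.le, e2]
    ring
  calc tailSum h n x R z
      ≤ ∑ j, ∑ i ∈ Finset.range I, K * n ^ 2 * (2 ^ i * R) ^ (-S) *
        (Metric.closedBall z (2 ^ (i + 1) * R / n)).indicator (fun _ => (1 : ℝ)) (x j) :=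
        Finset.sum_le_sum fun j _ => hpt (x j)
    _ = ∑ i ∈ Finset.range I, K * n ^ 2 * (2 ^ i * R) ^ (-S) *
          sampleCount (Metric.closedBall z (2 ^ (i + 1) * R / n)) x := by
        rw [Finset.sum_comm]
        exact Finset.sum_congr rfl fun i _ => (Finset.mul_sum _ _ _).symm
    _ ≤ ∑ i ∈ Finset.range I, K * n ^ 2 * (2 ^ i * R) ^ (-S) *
          (M * (G * (2 ^ (i + 1) * R) ^ α * m)) := by
        refine Finset.sum_le_sum fun i _ => mul_le_mul_of_nonneg_left ?_ (by positivity)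
        exact hx.upper z _ (one_le_mul_of_one_le_of_one_le (one_le_pow₀ one_le_two) hR)
    _ = M * (K * G * 2 ^ α * (n ^ 2 * m) * R ^ (-(S - α))) * ∑ i ∈ Finset.range I, q ^ i := by
        rw [Finset.mul_sum]
        refine Finset.sum_congr rfl fun i _ => ?_
        linear_combination (K * n ^ 2 * M * G * m) * hscale i
    _ ≤ M * (K * G * 2 ^ α * (n ^ 2 * m) * R ^ (-(S - α))) * (1 - q)⁻¹ := by gcongr
    _ = _ := by ring

theorem IsRegularSample.supportFn_le_of_forall_le_dist (hx : IsRegularSample μ α p G n x)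
    (hM : 1 ≤ M) (hn : 1 ≤ n) {R H : ℝ} {z : 𝕄} (hH : tailSum h n x R z ≤ M * H)
    (hz : ∀ y ∈ μ.support, R / n ≤ dist z y) : supportFn h n x z ≤ H := by
  have hM0 : (0 : ℝ) < M := by exact_mod_cast hM
  have hn0 : (0 : ℝ) < n := by exact_mod_cast hn
  rw [supportFn, one_div, inv_mul_le_iff₀ hM0]
  refine le_trans (Finset.sum_le_sum fun j _ => ?_) hH
  rw [indicator_of_mem]
  have := hz _ (hx.mem j)
  rwa [div_le_iff₀' hn0] at this

/-- Samples farther than `1 / n` are in the tail; the others are counted with the trivial kernel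
bound `9 n²`. -/
theorem IsRegularSample.supportFn_le (hx : IsRegularSample μ α p G n x) (hh : IsLowPass h)
    (hM : 1 ≤ M) (hn : 1 ≤ n) {H : ℝ} {z : 𝕄}
    (hH : tailSum h n x 1 z ≤ M * (H * (n ^ 2 * (n : ℝ) ^ (-α)))) :
    supportFn h n x z ≤ (H + 9 * G) * (n ^ 2 * (n : ℝ) ^ (-α)) := by
  have hM0 : (0 : ℝ) < M := by exact_mod_cast hM
  have hn0 : (0 : ℝ) < n := by exact_mod_cast hn
  rw [supportFn, one_div, inv_mul_le_iff₀ hM0]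
  have hup := hx.upper z 1 le_rfl
  rw [Real.one_rpow, mul_one] at hup
  calc ∑ j, sqKernel h n z (x j)
      ≤ tailSum h n x 1 z + 9 * n ^ 2 * sampleCount (Metric.closedBall z (1 / n)) x := by
        classical
        rw [tailSum, sampleCount, Finset.mul_sum, ← Finset.sum_add_distrib]
        refine Finset.sum_le_sum fun j _ => ?_
        have h0 : 0 ≤ 9 * (n : ℝ) ^ 2 *
            (Metric.closedBall z (1 / n)).indicator (fun _ => (1 : ℝ)) (x j) :=
          mul_nonneg (by positivity) (indicator_nonneg (fun _ _ => zero_le_one) _)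
        by_cases hy : 1 ≤ n * dist z (x j)
        · rw [indicator_of_mem (show x j ∈ {y | 1 ≤ n * dist z y} from hy)]
          linarith
        · have hb : x j ∈ Metric.closedBall z (1 / n) := by
            rw [Metric.mem_closedBall, dist_comm, le_div_iff₀' hn0]
            exact (not_le.1 hy).le
          rw [indicator_of_notMem (show x j ∉ {y | 1 ≤ n * dist z y} from hy),
            indicator_of_mem hb, mul_one, zero_add]
          exact hh.sqKernel_le hn _ _
    _ ≤ M * (H * (n ^ 2 * (n : ℝ) ^ (-α))) + 9 * n ^ 2 * (M * (G * (n : ℝ) ^ (-α))) := by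
        gcongr
    _ = _ := by ring

theorem IsRegularSample.le_supportFn (hx : IsRegularSample μ α p G n x) (hh : IsLowPass h)
    (hM : 1 ≤ M) (hn : 1 ≤ n) {z : 𝕄} (hz : z ∈ μ.support) :
    p / 4 * (n ^ 2 * (n : ℝ) ^ (-α)) ≤ supportFn h n x z := by
  have hM0 : (0 : ℝ) < M := by exact_mod_cast hM
  rw [supportFn, one_div, le_inv_mul_iff₀ hM0]
  calc M * (p / 4 * (n ^ 2 * (n : ℝ) ^ (-α))) = n ^ 2 / 4 * (M * (p * (n : ℝ) ^ (-α))) := by ring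
    _ ≤ n ^ 2 / 4 * sampleCount (Metric.closedBall z (1 / n)) x := by
        have := hx.lower z hz
        gcongr
    _ ≤ ∑ j, sqKernel h n z (x j) := by
        classical
        rw [sampleCount, Finset.mul_sum]
        refine Finset.sum_le_sum fun j _ => ?_
        by_cases hb : x j ∈ Metric.closedBall z (1 / n)
        · rw [indicator_of_mem hb, mul_one]
          exact hh.le_sqKernel hn (Metric.mem_closedBall'.1 hb)
        · rw [indicator_of_notMem hb, mul_zero]
          exact sq_nonneg _

end SupportEstimates

/-! ### Geometry of the classes and the overlap set. -/

section Classes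

variable {𝕄 : Type u} [MetricSpace 𝕄]

/-- The triangle inequality gives `2 η - 2 δ ≥ η`, up to an `ε` because the distance to a set need
not be attained. -/
theorem le_dist_of_mem_cthickening {A B : Set 𝕄} {η δ : ℝ} (hδ : 0 ≤ δ) (hδη : δ ≤ η / 2)
    (hAB : ∀ x ∈ A, ∀ y ∈ B, 2 * η ≤ dist x y) {y z : 𝕄}
    (hy : y ∈ Metric.cthickening δ A) (hz : z ∈ Metric.cthickening δ B) : η ≤ dist y z := by
  refine le_of_forall_pos_lt_add fun ε hε => ?_
  obtain ⟨a, ha, hya⟩ := Metric.mem_thickening_iff.1 (Metric.cthickening_subset_thickening'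
    (by linarith) (by linarith : δ < δ + ε / 2) A hy)
  obtain ⟨b, hb, hzb⟩ := Metric.mem_thickening_iff.1 (Metric.cthickening_subset_thickening'
    (by linarith) (by linarith : δ < δ + ε / 2) B hz)
  have h1 := hAB a ha b hb
  have h2 := dist_triangle4 a y z b
  rw [dist_comm a y] at h2
  linarith

variable [MeasurableSpace 𝕄] {μ : Measure 𝕄}

theorem FineStructure.cls_subset_support (F : FineStructure μ) {η : ℝ} (hη : 0 < η)
    (hη₀ : η ≤ F.η₀) (k : Fin (F.K η)) : F.cls η k ⊆ μ.support := by
  rw [← F.iUnion_eq η hη hη₀]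
  exact subset_iUnion (F.part η) k.castSucc

/-- If the overlap set carries less mass than the balls of radius `δ` centred in the support, then
every point of the support is `δ`-close to one of the classes. -/
theorem FineStructure.exists_dist_le_of_overlap_lt [CompactSpace 𝕄] [BorelSpace 𝕄]
    [IsFiniteMeasure μ] (F : FineStructure μ) {η : ℝ} (hη : 0 < η) (hη₀ : η ≤ F.η₀) {δ : ℝ} {z : 𝕄}
    (hz : μ.real (F.overlap η) < μ.real (Metric.closedBall z δ)) :
    ∃ k, ∃ y ∈ F.cls η k, dist z y ≤ δ := by
  by_contra! hfar
  refine hz.not_ge ?_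
  have hsub : Metric.closedBall z δ ⊆ F.overlap η ∪ μ.supportᶜ := by
    intro y hy
    by_cases hys : y ∈ μ.support
    · rw [← F.iUnion_eq η hη hη₀, mem_iUnion] at hys
      obtain ⟨k, hk⟩ := hys
      rcases Fin.eq_castSucc_or_eq_last k with ⟨k, rfl⟩ | rfl
      · exact absurd (Metric.mem_closedBall'.1 hy) (hfar k y hk).not_ge
      · exact Or.inl hk
    · exact Or.inr hys
  have h0 : μ.real μ.supportᶜ = 0 := by
    rw [measureReal_def, Measure.measure_compl_support, ENNReal.toReal_zero]
  calc μ.real (Metric.closedBall z δ) ≤ μ.real (F.overlap η ∪ μ.supportᶜ) := measureReal_mono hsub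
    _ ≤ μ.real (F.overlap η) + μ.real μ.supportᶜ := measureReal_union_le _ _
    _ = μ.real (F.overlap η) := by rw [h0, add_zero]

end Classes
end

/-! ### Choice of constants and the deterministic conclusion. -/

theorem mainTheorem3 (h : ℝ → ℝ) (hh : IsLowPass h) (α κ₁ κ₂ r₀ S : ℝ)
    (hα : 0 ≤ α) (hκ₁ : 0 < κ₁) (hκ₂ : 0 < κ₂) (hr₀ : 0 < r₀) (hr₀π : r₀ ≤ Real.pi)
    (hS : α < S) :
    ∃ C A₁ A₂ A₃ b₁ b₂ c c₁ c₂ : ℝ,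
      0 < C ∧ C < 1 ∧ 0 < A₁ ∧ 0 < A₂ ∧ 0 < A₃ ∧ 0 < b₁ ∧ 0 < b₂ ∧ 0 < c ∧ c < 1 ∧
      0 < c₁ ∧ 0 < c₂ ∧
    ∃ r : ℝ → ℝ,
      (∀ Θ, 0 < Θ → Θ < C →
        b₁ * Θ ^ (-1 / (S - α)) ≤ r Θ ∧ r Θ ≤ b₂ * Θ ^ (-1 / (S - α))) ∧
    ∀ (𝕄 : Type u) [MetricSpace 𝕄] [CompactSpace 𝕄] [MeasurableSpace 𝕄] [BorelSpace 𝕄],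
      Metric.diam (Set.univ : Set 𝕄) = Real.pi →
    ∀ (μ : Measure 𝕄) [IsProbabilityMeasure μ], IsDetectable μ α κ₁ κ₂ r₀ →
    ∀ (F : FineStructure μ) (η Θ : ℝ) (n M : ℕ),
      0 < η → η ≤ F.η₀ → 0 < Θ → Θ < C → 1 ≤ n → 1 ≤ M →
      A₁ * ((n : ℝ) ^ α * Real.log n) ≤ M →
      A₂ * (1 / (η * Θ ^ (1 / (S - α)))) ≤ n →
      μ.real (F.overlap η) ≤ A₃ * (Θ * (n : ℝ) ^ (-α)) →
      Measure.pi (fun _ : Fin M => μ) {x : Fin M → 𝕄 | ¬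
        (μ.support ⊆ supportSet h n x Θ ∧
         supportSet h n x Θ ⊆ Metric.cthickening (r Θ / n) μ.support ∧
         (⋃ k, classSet h n x Θ (r Θ) (F.cls η k)) = supportSet h n x Θ ∧
         (∀ j k, j ≠ k →
            Disjoint (classSet h n x Θ (r Θ) (F.cls η j))
              (classSet h n x Θ (r Θ) (F.cls η k))) ∧
         (∀ k, (F.cls η k).Nonempty → (classSet h n x Θ (r Θ) (F.cls η k)).Nonempty) ∧
         (∀ j k, j ≠ k → ∀ y ∈ classSet h n x Θ (r Θ) (F.cls η j),
            ∀ z ∈ classSet h n x Θ (r Θ) (F.cls η k), η ≤ dist y z) ∧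
         (∀ k, μ.support ∩ Metric.cthickening (c * r Θ / n) (F.cls η k) ⊆
              classSet h n x Θ (r Θ) (F.cls η k) ∧
            classSet h n x Θ (r Θ) (F.cls η k) ⊆
              Metric.cthickening (r Θ / n) (F.cls η k)))}
        ≤ ENNReal.ofReal (c₁ / (M : ℝ) ^ c₂) := by
  obtain ⟨p, G, A₁, c₁, c₂, hp, hG, hA₁, hc₁, hc₂, hprob⟩ :=
    exists_measure_not_isRegularSample_le.{u} hα hκ₁ hκ₂ hr₀
  obtain ⟨K, hK, hker⟩ := IsLowPass.exists_sqKernel_le.{u} hh S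
  have hSα : 0 < S - α := sub_pos.2 hS
  have hq1 : (2 : ℝ) ^ (-(S - α)) < 1 :=
    Real.rpow_lt_one_of_one_lt_of_neg (by norm_num) (by linarith)
  have hq : 0 < (1 - (2 : ℝ) ^ (-(S - α)))⁻¹ := inv_pos.2 (by linarith)
  set H := K * G * 2 ^ α * (1 - (2 : ℝ) ^ (-(S - α)))⁻¹ with hH
  have hH0 : 0 < H := by positivity
  -- Chosen so that with `R = (D / Θ)^(1 / (S - α))` the far-field bound `H R^(-(S - α))` is half of
  -- the threshold `Θ (p / 4)`.
  set D := 2 * H / (p / 4) with hD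
  have hD0 : 0 < D := by positivity
  set ρ := min 1 r₀ with hρ
  have hρ0 : 0 < ρ := lt_min one_pos hr₀
  set β := D ^ (1 / (S - α)) with hβ
  have hβ0 : 0 < β := by positivity
  set R : ℝ → ℝ := fun Θ => β * Θ ^ (-1 / (S - α)) with hR
  -- The three terms of `C` give `Θ < 1`, the inclusion of the support, and `R Θ ≥ 1`. `4 * β`
  -- yields `2 R / n ≤ η / 2`, and `κ₂ * ρ ^ α` makes the overlap lighter than balls of radius `ρ /
  -- n` about support points. The radius is `2 R Θ`: one `R Θ / n` to reach the support, another to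
  -- reach a class.
  refine ⟨min (1 / 2) (min (p / 4 / (H + 9 * G)) D), A₁, 4 * β, κ₂ * ρ ^ α, 2 * β, 2 * β, 1 / 2,
    c₁, c₂, by positivity, (min_le_left _ _).trans_lt (by norm_num), hA₁, by positivity,
    by positivity, by positivity, by positivity, by norm_num, by norm_num, hc₁, hc₂,
    fun Θ => 2 * R Θ, fun Θ _ _ => ⟨(mul_assoc _ _ _).le, (mul_assoc _ _ _).ge⟩, ?_⟩
  intro 𝕄 _ _ _ _ hdiam μ _ hμ F η Θ n M hη hη₀ hΘ hΘC hn hM hMn hnη hover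
  have hΘ1 : Θ < 1 := (hΘC.trans_le (min_le_left _ _)).trans_le (by norm_num)
  have hΘU : Θ * (H + 9 * G) ≤ p / 4 := by
    rw [← le_div_iff₀ (by positivity)]
    exact (hΘC.trans_le ((min_le_right _ _).trans (min_le_left _ _))).le
  have hΘD : Θ ≤ D := (hΘC.trans_le ((min_le_right _ _).trans (min_le_right _ _))).le
  have hdist := dist_le_of_diam_univ hdiam
  have hn0 : (0 : ℝ) < n := by exact_mod_cast hn
  have hn1 : (1 : ℝ) ≤ n := by exact_mod_cast hn
  have hRΘ : R Θ = (D / Θ) ^ (1 / (S - α)) := by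
    rw [Real.div_rpow hD0.le hΘ.le, div_eq_mul_inv, ← Real.rpow_neg hΘ.le, ← neg_div]
  have hR1 : 1 ≤ R Θ := by
    rw [hRΘ]
    exact Real.one_le_rpow ((one_le_div hΘ).2 hΘD) (by positivity)
  have hRpow : H * R Θ ^ (-(S - α)) = Θ * (p / 4) / 2 := by
    rw [hRΘ, ← Real.rpow_mul (by positivity), mul_neg, one_div_mul_cancel hSα.ne',
      Real.rpow_neg_one, hD]
    field_simp
  have hRη : 2 * R Θ / n ≤ η / 2 := by
    rw [div_le_iff₀ hn0]
    refine le_trans (le_of_eq ?_) (mul_le_mul_of_nonneg_left hnη (by positivity : 0 ≤ η / 2))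
    simp only [hR]
    rw [neg_div, Real.rpow_neg hΘ.le]
    field_simp
    ring
  have hRn : 0 ≤ 2 * R Θ / n := by positivity
  set m := (n : ℝ) ^ 2 * (n : ℝ) ^ (-α) with hm
  have hm0 : 0 < m := by positivity
  have hnear : ∀ y ∈ μ.support, ∃ k, ∃ w ∈ F.cls η k, dist y w ≤ ρ / n := by
    intro y hy
    refine F.exists_dist_le_of_overlap_lt hη hη₀ (hover.trans_lt ?_)
    refine lt_of_lt_of_le ?_ (hμ.lower y hy (ρ / n) (by positivity)
      ((div_le_self hρ0.le hn1).trans (min_le_right _ _)))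
    rw [div_natCast_rpow hρ0.le, ← mul_assoc, ← mul_assoc, mul_right_comm]
    exact mul_lt_of_lt_one_right (by positivity) hΘ1
  refine (measure_mono fun x hx => ?_).trans (hprob 𝕄 hdiam μ hμ n M hn hM hMn)
  refine fun hreg => hx ?_
  have : Nonempty (Fin M) := ⟨⟨0, hM⟩⟩
  have htail : ∀ {R : ℝ}, 1 ≤ R → ∀ z, tailSum h n x R z ≤ M * (H * m * R ^ (-(S - α))) :=
    fun hR z => hreg.tailSum_le hdist hn hS (hα.trans hS.le) hK hG
      (fun y w h1 => hker 𝕄 n y w hn (hdist y w) h1) hR z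
  have hsub : μ.support ⊆ supportSet h n x Θ :=
    subset_supportSet hΘ.le
      (fun z => hreg.supportFn_le hh hM hn (H := H) (by simpa using htail le_rfl z))
      (fun z hz => hreg.le_supportFn hh hM hn hz)
      (by rw [← mul_assoc]; gcongr)
  -- A point violating this has estimator value at most half of what membership forces.
  have hclose : ∀ z ∈ supportSet h n x Θ, ∃ y ∈ μ.support, dist z y < R Θ / n := by
    intro z hz
    by_contra! hfar
    have h1 := hreg.supportFn_le_of_forall_le_dist hM hn (htail hR1 z) hfar
    have h2 := mul_le_supportFn_of_mem_supportSet hΘ.le ⟨0, hM⟩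
      (hreg.le_supportFn hh hM hn (hreg.mem _)) hz
    have h3 : H * m * R Θ ^ (-(S - α)) = Θ * (p / 4 * m) / 2 := by
      rw [mul_right_comm, hRpow]
      ring
    have h4 : 0 < Θ * (p / 4 * m) := by positivity
    linarith
  -- Only `1 / 2 ≤ 1` matters here: the support is already accepted, and thickenings are monotone in
  -- the radius.
  have hcls : ∀ k, μ.support ∩ Metric.cthickening (1 / 2 * (2 * R Θ) / n) (F.cls η k) ⊆
      classSet h n x Θ (2 * R Θ) (F.cls η k) := fun k =>
    inter_subset_inter hsub (Metric.cthickening_mono (by gcongr ?_ / _; linarith) _)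
  have hsep : ∀ j k, j ≠ k → ∀ y ∈ classSet h n x Θ (2 * R Θ) (F.cls η j),
      ∀ z ∈ classSet h n x Θ (2 * R Θ) (F.cls η k), η ≤ dist y z := fun j k hjk y hy z hz =>
    le_dist_of_mem_cthickening hRn hRη (F.separated η hη hη₀ j k hjk) hy.2 hz.2
  refine ⟨hsub, fun z hz => ?_, ?_, fun j k hjk => ?_, fun k hk => ?_, hsep,
    fun k => ⟨hcls k, inter_subset_right⟩⟩
  · obtain ⟨y, hy, hzy⟩ := hclose z hz
    refine Metric.mem_cthickening_of_dist_le z y _ _ hy (hzy.le.trans ?_)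
    gcongr
    linarith
  · refine (iUnion_subset fun k => inter_subset_left).antisymm fun z hz => ?_
    obtain ⟨y, hy, hzy⟩ := hclose z hz
    obtain ⟨k, w, hw, hyw⟩ := hnear y hy
    refine mem_iUnion.2 ⟨k, hz, Metric.mem_cthickening_of_dist_le z w _ _ hw ?_⟩
    have h1 : ρ / n ≤ R Θ / n := by
      gcongr
      exact (min_le_left _ _).trans hR1
    change dist z w ≤ 2 * R Θ / n
    rw [two_mul, add_div]
    linarith [dist_triangle z y w]
  · refine Set.disjoint_left.2 fun z hzj hzk => ?_
    have := hsep j k hjk z hzj z hzk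
    rw [dist_self] at this
    exact hη.not_ge this
  · obtain ⟨y, hy⟩ := hk
    exact ⟨y, hcls k ⟨F.cls_subset_support hη hη₀ k hy,
      Metric.self_subset_cthickening _ hy⟩⟩
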